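/- Let $n\ge 1$ be an integer and let $\chi_n$ denote the standardized Legendre polynomial of degree $n$, given by Rodrigues' formula $$\chi_n(t)=\frac{1}{2^n n!}\,\frac{d^n}{dt^n}\left[(t^2-1)^n\right].$$ For a real number $\gamma\ge 1$ put $$E_{n,\gamma}=\left\{x\in\mathbb R^n:\ \sum_{j=1}^n|x_j|+\left|1-\sum_{j=1}^n x_j\right|\le\gamma\right\}.$$ Then for every $\gamma\ge 1$ the $n$-dimensional Lebesgue measure $\mathrm{mes}_n(E_{n,\gamma})$ is given by $$\mathrm{mes}_n(E_{n,\gamma})=\frac{1}{2^n n!}\sum_{i=0}^{n}\binom{n}{i}^2(\gamma-1)^{n-i}(\gamma+1)^i=\frac{\chi_n(\gamma)}{n!}.$$ In particular, $\chi_n(\gamma)=n!\,\mathrm{mes}_n(E_{n,\gamma})$ for all $\gamma\ge 1$. -/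

import Mathlib

open MeasureTheory

/-- The standardized Legendre polynomial `χ_n` of degree `n`, given by the Rodrigues formula
`χ_n(t) = (1 / (2^n n!)) (d/dt)^n [(t^2 - 1)^n]`. -/
noncomputable def legendreChi (n : ℕ) : Polynomial ℝ :=
  Polynomial.C (1 / ((2 : ℝ) ^ n * (n.factorial : ℝ))) *
    Polynomial.derivative^[n] ((Polynomial.X ^ 2 - 1) ^ n)

/-- The set `E_{n,γ}` of all `x ∈ ℝ^n` with `∑ |x_j| + |1 - ∑ x_j| ≤ γ`. -/
def setE (n : ℕ) (γ : ℝ) : Set (Fin n → ℝ) :=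
  {x | (∑ j, |x j|) + |1 - ∑ j, x j| ≤ γ}

/-!
Let `P` and `N` be the sums of the positive and of the negative parts of the coordinates of `x`.
Then `∑ |x j| = P + N` and `∑ x j = P - N`, so `x ∈ setE n γ` exactly when `P ≤ (γ + 1) / 2` and
`N ≤ (γ - 1) / 2` (`setE_eq_posNegRegion`). Split by the signs of the coordinates, the region
`P ≤ a`, `N ≤ b` has volume `∑ i, n.choose i * (a ^ i / i!) * (b ^ (n - i) / (n - i)!)`. To avoid
the splitting over orthants, this is proved by induction on `n` (`volume_posNegRegion`): the volume
is sliced along the first coordinate, and the closed form satisfies the resulting recursion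
(`posNegVolume_succ`). For the bounds above the sum becomes the one in the claim
(`posNegVolume_half`), and Leibniz' rule turns Rodrigues' formula into the same sum
(`eval_legendreChi`).
-/

/-- The region of points of `ℝⁿ` whose positive parts sum to at most `a` and whose negative parts
sum to at most `b`. -/
def posNegRegion (n : ℕ) (a b : ℝ) : Set (Fin n → ℝ) :=
  {x | ∑ j, max (x j) 0 ≤ a ∧ ∑ j, max (-x j) 0 ≤ b}

/-- With `P` and `N` the sums of the positive and negative parts, the defining condition reads
`P + N + |1 - P + N| ≤ γ`; the two signs of the absolute value bound `N` and `P` separately. -/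
theorem setE_eq_posNegRegion (n : ℕ) (γ : ℝ) :
    setE n γ = posNegRegion n ((γ + 1) / 2) ((γ - 1) / 2) := by
  ext x
  have h1 : ∑ j, |x j| = ∑ j, max (x j) 0 + ∑ j, max (-x j) 0 := by
    rw [← Finset.sum_add_distrib]
    refine Finset.sum_congr rfl fun j _ => ?_
    rcases le_total 0 (x j) with h | h
    · rw [abs_of_nonneg h, max_eq_left h, max_eq_right (by linarith), add_zero]
    · rw [abs_of_nonpos h, max_eq_right h, max_eq_left (by linarith), zero_add]
  have h2 : ∑ j, x j = ∑ j, max (x j) 0 - ∑ j, max (-x j) 0 := by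
    rw [← Finset.sum_sub_distrib]
    refine Finset.sum_congr rfl fun j _ => ?_
    rcases le_total 0 (x j) with h | h
    · rw [max_eq_left h, max_eq_right (by linarith), sub_zero]
    · rw [max_eq_right h, max_eq_left (by linarith)]; ring
  simp only [setE, posNegRegion, Set.mem_ofPred_eq]
  rw [h1, h2, ← le_sub_iff_add_le', abs_le]
  constructor
  · rintro ⟨h, h'⟩
    constructor <;> linarith
  · rintro ⟨h, h'⟩
    constructor <;> linarith

/-- The closed form of the volume of `posNegRegion n a b` for `a, b ≥ 0`: choosing which `i` of the
`n` coordinates are positive leaves the product of a simplex of size `a` and one of size `b`. -/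
noncomputable def posNegVolume (n : ℕ) (a b : ℝ) : ℝ :=
  ∑ p ∈ Finset.HasAntidiagonal.antidiagonal n,
    (n.choose p.1 : ℝ) * (a ^ p.1 / (p.1.factorial : ℝ) * (b ^ p.2 / (p.2.factorial : ℝ)))

theorem isClosed_posNegRegion (n : ℕ) (a b : ℝ) : IsClosed (posNegRegion n a b) := by
  have h : posNegRegion n a b =
      {x | ∑ j, max (x j) 0 ≤ a} ∩ {x | ∑ j, max (-x j) 0 ≤ b} := rfl
  rw [h]
  exact (isClosed_le (by fun_prop) continuous_const).inter
    (isClosed_le (by fun_prop) continuous_const)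

theorem posNegRegion_eq_empty {n : ℕ} {a b : ℝ} (h : a < 0 ∨ b < 0) :
    posNegRegion n a b = ∅ := by
  refine Set.eq_empty_of_forall_notMem fun x hx => ?_
  have h1 : 0 ≤ ∑ j, max (x j) 0 := Finset.sum_nonneg fun j _ => le_max_right _ _
  have h2 : 0 ≤ ∑ j, max (-x j) 0 := Finset.sum_nonneg fun j _ => le_max_right _ _
  rcases h with h | h <;> linarith [hx.1, hx.2]

theorem posNegVolume_nonneg (n : ℕ) {a b : ℝ} (ha : 0 ≤ a) (hb : 0 ≤ b) :
    0 ≤ posNegVolume n a b :=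
  Finset.sum_nonneg fun _ _ => by positivity

theorem continuous_posNegVolume (n : ℕ) :
    Continuous fun p : ℝ × ℝ => posNegVolume n p.1 p.2 := by
  unfold posNegVolume
  fun_prop

/-- Fubini in the first coordinate `t`, which uses up `max t 0` of the bound `a` and `max (-t) 0` of
the bound `b`. -/
theorem volume_posNegRegion_succ (n : ℕ) (a b : ℝ) :
    volume (posNegRegion (n + 1) a b) =
      ∫⁻ t : ℝ, volume (posNegRegion n (a - max t 0) (b - max (-t) 0)) := by
  have e := (volume_preserving_piFinSuccAbove (fun _ : Fin (n + 1) => ℝ) 0).symm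
  have hm := (isClosed_posNegRegion (n + 1) a b).measurableSet
  rw [← e.measure_preimage hm.nullMeasurableSet, Measure.volume_eq_prod,
    Measure.prod_apply (e.measurable hm)]
  refine lintegral_congr fun t => ?_
  congr 1
  ext y
  simp only [posNegRegion, Set.mem_preimage, Set.mem_ofPred_eq, Fin.sum_univ_succ,
    MeasurableEquiv.piFinSuccAbove_symm_apply, Fin.insertNthEquiv_apply, Fin.insertNth_zero',
    Fin.cons_zero, Fin.cons_succ, le_sub_iff_add_le']

theorem integral_sub_pow_div_factorial (c : ℝ) (i : ℕ) :
    ∫ t in (0 : ℝ)..c, (c - t) ^ i / (i.factorial : ℝ) =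
      c ^ (i + 1) / ((i + 1).factorial : ℝ) := by
  rw [intervalIntegral.integral_comp_sub_left (fun t => t ^ i / (i.factorial : ℝ)),
    intervalIntegral.integral_div, integral_pow, Nat.factorial_succ]
  push_cast
  have := Nat.factorial_ne_zero i
  field_simp
  simp

/-- The closed form obeys the recursion that slicing imposes on the volume; the binomial
coefficients combine by Pascal's rule. -/
theorem posNegVolume_succ (n : ℕ) (a b : ℝ) :
    posNegVolume (n + 1) a b =
      (∫ t in (0 : ℝ)..b, posNegVolume n a (b - t)) +
        ∫ t in (0 : ℝ)..a, posNegVolume n (a - t) b := by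
  unfold posNegVolume
  rw [Finset.sum_antidiagonal_choose_succ_mul
    (fun i j => a ^ i / (i.factorial : ℝ) * (b ^ j / (j.factorial : ℝ))) n,
    intervalIntegral.integral_finsetSum, intervalIntegral.integral_finsetSum]
  · congr 1
    · refine Finset.sum_congr rfl fun p _ => ?_
      rw [intervalIntegral.integral_const_mul, intervalIntegral.integral_const_mul,
        integral_sub_pow_div_factorial]
    · refine Finset.sum_congr rfl fun p hp => ?_
      rw [intervalIntegral.integral_const_mul, intervalIntegral.integral_mul_const,
        integral_sub_pow_div_factorial,
        Nat.choose_symm_of_eq_add (Finset.HasAntidiagonal.mem_antidiagonal.1 hp).symm]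
  · exact fun p _ => Continuous.intervalIntegrable (by fun_prop) _ _
  · exact fun p _ => Continuous.intervalIntegrable (by fun_prop) _ _

theorem volume_posNegRegion (n : ℕ) {a b : ℝ} (ha : 0 ≤ a) (hb : 0 ≤ b) :
    volume (posNegRegion n a b) = ENNReal.ofReal (posNegVolume n a b) := by
  induction n generalizing a b with
  | zero =>
    have : posNegRegion 0 a b = Set.univ := by
      ext x; simp [posNegRegion, ha, hb]
    rw [this, volume_pi, Measure.pi_univ]
    simp [posNegVolume]
  | succ n ih =>
    have hc : Continuous fun t : ℝ => posNegVolume n (a - max t 0) (b - max (-t) 0) :=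
      (continuous_posNegVolume n).comp
        (f := fun t : ℝ => (a - max t 0, b - max (-t) 0)) (by fun_prop)
    have hmem : ∀ t ∈ Set.Icc (-b) a, 0 ≤ a - max t 0 ∧ 0 ≤ b - max (-t) 0 := fun t ht =>
      ⟨sub_nonneg.2 (max_le ht.2 ha), sub_nonneg.2 (max_le (by linarith [ht.1]) hb)⟩
    -- Slices are empty unless the first coordinate lies in `[-b, a]`.
    have hslice : ∀ t : ℝ, volume (posNegRegion n (a - max t 0) (b - max (-t) 0)) =
        (Set.Icc (-b) a).indicator
          (fun t => ENNReal.ofReal (posNegVolume n (a - max t 0) (b - max (-t) 0))) t := by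
      intro t
      by_cases ht : t ∈ Set.Icc (-b) a
      · rw [Set.indicator_of_mem ht, ih (hmem t ht).1 (hmem t ht).2]
      · rw [Set.indicator_of_notMem ht, posNegRegion_eq_empty, measure_empty]
        rw [Set.mem_Icc, not_and_or, not_le, not_le] at ht
        rcases ht with h | h
        · exact Or.inr (by linarith [le_max_left (-t) 0])
        · exact Or.inl (by linarith [le_max_left t 0])
    -- On either side of `0` one of the two bounds is constant and the other is linear.
    have hneg : ∫ t in (-b)..0, posNegVolume n (a - max t 0) (b - max (-t) 0) =
        ∫ t in (0 : ℝ)..b, posNegVolume n a (b - t) := by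
      have h := intervalIntegral.integral_comp_neg (a := -b) (b := 0)
        (fun t => posNegVolume n a (b - t))
      rw [neg_zero, neg_neg] at h
      rw [← h]
      refine intervalIntegral.integral_congr fun t ht => ?_
      rw [Set.uIcc_of_le (by linarith)] at ht
      simp only [max_eq_right ht.2, max_eq_left (neg_nonneg.2 ht.2), sub_zero]
    have hpos : ∫ t in (0 : ℝ)..a, posNegVolume n (a - max t 0) (b - max (-t) 0) =
        ∫ t in (0 : ℝ)..a, posNegVolume n (a - t) b := by
      refine intervalIntegral.integral_congr fun t ht => ?_
      rw [Set.uIcc_of_le ha] at ht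
      simp only [max_eq_left ht.1, max_eq_right (neg_nonpos.2 ht.1), sub_zero]
    rw [volume_posNegRegion_succ, lintegral_congr hslice, lintegral_indicator measurableSet_Icc,
      ← ofReal_integral_eq_lintegral_ofReal (hc.integrableOn_Icc)
        (ae_restrict_of_forall_mem measurableSet_Icc fun t ht =>
          posNegVolume_nonneg n (hmem t ht).1 (hmem t ht).2),
      integral_Icc_eq_integral_Ioc, ← intervalIntegral.integral_of_le (by linarith),
      ← intervalIntegral.integral_add_adjacent_intervals (hc.intervalIntegrable (-b) 0)
        (hc.intervalIntegrable 0 a), hneg, hpos, posNegVolume_succ]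

theorem posNegVolume_half (n : ℕ) (γ : ℝ) :
    posNegVolume n ((γ + 1) / 2) ((γ - 1) / 2) =
      1 / ((2 : ℝ) ^ n * (n.factorial : ℝ)) *
        ∑ i ∈ Finset.range (n + 1),
          ((n.choose i : ℝ)) ^ 2 * (γ - 1) ^ (n - i) * (γ + 1) ^ i := by
  rw [posNegVolume, Finset.Nat.sum_antidiagonal_eq_sum_range_succ_mk, Finset.mul_sum]
  refine Finset.sum_congr rfl fun i hi => ?_
  have hi : i ≤ n := Nat.lt_succ_iff.1 (Finset.mem_range.1 hi)
  have h2 : (2 : ℝ) ^ n = 2 ^ i * 2 ^ (n - i) := by rw [← pow_add, Nat.add_sub_cancel' hi]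
  have hf : (n.factorial : ℝ) = n.choose i * i.factorial * (n - i).factorial := by
    exact_mod_cast (Nat.choose_mul_factorial_mul_factorial hi).symm
  have hc : (n.choose i : ℝ) ≠ 0 := by exact_mod_cast (Nat.choose_pos hi).ne'
  have := Nat.factorial_ne_zero i
  have := Nat.factorial_ne_zero (n - i)
  rw [h2, hf, div_pow, div_pow]
  field_simp

/-- Leibniz' rule applied to `(t ^ 2 - 1) ^ n = (t + 1) ^ n * (t - 1) ^ n` in Rodrigues' formula. -/
theorem eval_legendreChi (n : ℕ) (t : ℝ) :
    (legendreChi n).eval t = 1 / (2 : ℝ) ^ n *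
      ∑ i ∈ Finset.range (n + 1), ((n.choose i : ℝ)) ^ 2 * (t - 1) ^ (n - i) * (t + 1) ^ i := by
  have hfac : ((Polynomial.X : Polynomial ℝ) ^ 2 - 1) ^ n =
      (Polynomial.X + Polynomial.C 1) ^ n * (Polynomial.X - Polynomial.C 1) ^ n := by
    rw [← mul_pow, Polynomial.C_1]; ring
  rw [legendreChi, hfac, Polynomial.iterate_derivative_mul, Polynomial.eval_mul,
    Polynomial.eval_C, Polynomial.eval_finsetSum, Finset.mul_sum, Finset.mul_sum]
  refine Finset.sum_congr rfl fun i hi => ?_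
  have hi : i ≤ n := Nat.lt_succ_iff.1 (Finset.mem_range.1 hi)
  rw [Polynomial.iterate_derivative_X_add_pow, Polynomial.iterate_derivative_X_sub_pow,
    Nat.sub_sub_self hi]
  have hd : (n.descFactorial (n - i) : ℝ) * n.descFactorial i = n.factorial * n.choose i := by
    have h1 := Nat.factorial_mul_descFactorial (Nat.sub_le n i)
    rw [Nat.sub_sub_self hi] at h1
    have h2 := Nat.descFactorial_eq_factorial_mul_choose n i
    rw [← h1, h2]; push_cast; ring
  have hn : (n.factorial : ℝ) ≠ 0 := by exact_mod_cast Nat.factorial_ne_zero n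
  simp only [nsmul_eq_mul, Polynomial.eval_mul, Polynomial.eval_natCast, Polynomial.eval_pow,
    Polynomial.eval_add, Polynomial.eval_sub, Polynomial.eval_X, Polynomial.eval_C]
  field_simp
  -- `hd` collects the falling factorials produced by the derivatives of the two factors.
  linear_combination (n.choose i * (t + 1) ^ i * (t - 1) ^ (n - i) : ℝ) * hd

theorem mainTheorem2 (n : ℕ) (hn : 1 ≤ n) (γ : ℝ) (hγ : 1 ≤ γ) :
    volume (setE n γ) =
        ENNReal.ofReal (1 / ((2 : ℝ) ^ n * (n.factorial : ℝ)) *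
          ∑ i ∈ Finset.range (n + 1),
            ((n.choose i : ℝ)) ^ 2 * (γ - 1) ^ (n - i) * (γ + 1) ^ i) ∧
      1 / ((2 : ℝ) ^ n * (n.factorial : ℝ)) *
          ∑ i ∈ Finset.range (n + 1),
            ((n.choose i : ℝ)) ^ 2 * (γ - 1) ^ (n - i) * (γ + 1) ^ i =
        (legendreChi n).eval γ / (n.factorial : ℝ) ∧
      (legendreChi n).eval γ = (n.factorial : ℝ) * (volume (setE n γ)).toReal := by
  have ha : 0 ≤ (γ + 1) / 2 := by linarith
  have hb : 0 ≤ (γ - 1) / 2 := by linarith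
  have hvol : volume (setE n γ) =
      ENNReal.ofReal (posNegVolume n ((γ + 1) / 2) ((γ - 1) / 2)) := by
    rw [setE_eq_posNegRegion, volume_posNegRegion n ha hb]
  have hchi : posNegVolume n ((γ + 1) / 2) ((γ - 1) / 2) =
      (legendreChi n).eval γ / (n.factorial : ℝ) := by
    rw [posNegVolume_half, eval_legendreChi]
    ring
  have hn0 : (n.factorial : ℝ) ≠ 0 := by exact_mod_cast Nat.factorial_ne_zero n
  rw [← posNegVolume_half]
  refine ⟨hvol, hchi, ?_⟩
  rw [hvol, ENNReal.toReal_ofReal (posNegVolume_nonneg n ha hb), hchi, mul_div_cancel₀ _ hn0]
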